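/- **Lemma 3.32.** Let $n, r \ge 0$ be integers and let $K_1,\dots,K_r \in \mathbb{C}[[x_1,\dots,x_n]]$ be formal power series. Let $\mathcal{I}(K)$ be the ideal of $\mathbb{C}[[x_1,\dots,x_n]]$ generated by $K_1,\dots,K_r$. Then the following are equivalent: (i) the complex vector space $\mathbb{C}[[x_1,\dots,x_n]]/\mathcal{I}(K)$ is infinite-dimensional; (ii) there exists $\mu=(\mu_1,\dots,\mu_n)$ with $\mu_1,\dots,\mu_n\in\mathbb{C}[[s]]$, all with zero constant term and not all zero, such that $K_j(\mu(s)) = 0$ in $\mathbb{C}[[s]]$ for all $1\le j\le r$. -/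

import Mathlib

/-- `f(μ(s))`: the composition of a formal power series `f ∈ ℂ⟦x₁,…,xₙ⟧` with an `n`-tuple `μ` of formal
power series in one variable `s`. This is substitution of formal power series, meaningful when all the `μᵢ` have
zero constant term, the only case in which it is used. -/
noncomputable def formalComp {n : ℕ} (f : MvPowerSeries (Fin n) ℂ) (μ : Fin n → PowerSeries ℂ) :
    PowerSeries ℂ :=
  MvPowerSeries.subst μ f

/-!
If `𝓘(K)` contains no power of the maximal ideal `𝔪`, choose `P ⊇ 𝓘(K)` maximal among the primes
different from `𝔪`, and a variable `xᵢ ∉ P`. Then `D = k⟦x₁, …, xₙ⟧ ⧸ P` is a one-dimensional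
local domain, so `D ⧸ xᵢD` has finite length and completeness makes `D` finite over `k⟦xᵢ⟧`. The
integral closure of `k⟦xᵢ⟧` in `Frac D` is again finite, hence Dedekind; localising it at a maximal
ideal and expanding in powers of a uniformizer embeds `D` into `k⟦s⟧`. The images of the variables
form the curve `μ`. Conversely, if the quotient is finite-dimensional, so is the image in `k⟦s⟧` of
any substitution killing `𝓘(K)`; being a domain, this image is a field, so all variables go to `0`.
-/

open IsLocalRing Module

theorem ker_algHom_eq_maximalIdeal {k R : Type*} [Field k] [CommRing R] [IsLocalRing R]
    [Algebra k R] (χ : R →ₐ[k] k) : RingHom.ker χ = maximalIdeal R :=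
  eq_maximalIdeal <| RingHom.ker_isMaximal_of_surjective χ fun c ↦ ⟨algebraMap k R c, χ.commutes c⟩

section CompleteModules

variable {A M : Type*} [CommRing A] [AddCommGroup M] [Module A M] {I : Ideal A}

theorem isPrecomplete_of_finite [IsPrecomplete I A] [Module.Finite A M] : IsPrecomplete I M := by
  rw [← AdicCompletion.of_surjective_iff]
  intro x
  obtain ⟨t, rfl⟩ := AdicCompletion.ofTensorProduct_surjective_of_finite I M x
  induction t with
  | zero => exact ⟨0, by simp only [map_zero]⟩
  | tmul a m =>
    obtain ⟨a, rfl⟩ := AdicCompletion.of_surjective I A a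
    exact ⟨a • m, rfl⟩
  | add s t hs ht =>
    obtain ⟨y, hy⟩ := hs
    obtain ⟨z, hz⟩ := ht
    exact ⟨y + z, by rw [map_add, map_add, hy, hz]⟩

variable (I) in
theorem finite_of_finite_quotient_smul_top [IsPrecomplete I A] [IsHausdorff I M]
    [Module.Finite A (M ⧸ (I • ⊤ : Submodule A M))] : Module.Finite A M := by
  obtain ⟨n, f, hf⟩ := Module.Finite.exists_fin' A (M ⧸ (I • ⊤ : Submodule A M))
  obtain ⟨g, hg⟩ := Module.projective_lifting_property (Submodule.mkQ (I • ⊤)) f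
    (Submodule.mkQ_surjective _)
  have : IsPrecomplete I (Fin n → A) := isPrecomplete_of_finite
  exact .of_surjective g (surjective_of_mkQ_comp_surjective (I := I) (hg ▸ hf))

end CompleteModules

section FiniteQuotients

theorem finite_residueField_of_surjective {A R S : Type*} [CommRing A] [CommRing R] [CommRing S]
    [IsLocalRing R] [IsLocalRing S] [Algebra A R] [Algebra A S] [Module.Finite A (ResidueField R)]
    (f : R →ₐ[A] S) (hf : Function.Surjective f) : Module.Finite A (ResidueField S) := by
  have : IsLocalHom f.toRingHom := .of_surjective f.toRingHom hf
  have : IsLocalHom f := ⟨this.map_nonunit⟩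
  exact .of_surjective (ResidueField.mapAlgHom f).toLinearMap <|
    .of_comp (g := residue R) (residue_surjective.comp hf)

theorem finite_quotient_of_le_radical {A R : Type*} [CommRing A] [CommRing R] [Algebra A R]
    {I J : Ideal R} (hJ : J.FG) (hJI : J ≤ I.radical) [Module.Finite A (R ⧸ J)] :
    Module.Finite A (R ⧸ I) := by
  let f : (R ⧸ I) →ₐ[A] R ⧸ (I ⊔ J) := Ideal.Quotient.factorₐ A le_sup_left
  have hker : RingHom.ker f = J.map (Ideal.Quotient.mk I) := by
    have := Ideal.Quotient.factor_ker (le_sup_left : I ≤ I ⊔ J)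
    rwa [Ideal.map_sup, Ideal.map_quotient_self, bot_sup_eq] at this
  have : Module.Finite A (R ⧸ (I ⊔ J)) :=
    .of_surjective (Ideal.Quotient.factorₐ A (le_sup_right : J ≤ I ⊔ J)).toLinearMap
      (Ideal.Quotient.factor_surjective le_sup_right)
  refine finite_of_surjective_of_ker_le_nilradical f
    (Ideal.Quotient.factor_surjective le_sup_left) ?_ (hker ▸ hJ.map _)
  rwa [hker, Ideal.map_le_iff_le_comap, nilradical, Ideal.comap_radical, Ideal.zero_eq_bot,
    ← RingHom.ker_eq_comap_bot, Ideal.mk_ker]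

theorem finite_of_radical_map_eq_maximalIdeal {A D : Type*} [CommRing A] [CommRing D]
    [IsNoetherianRing D] [IsLocalRing D] [Algebra A D] [Module.Finite A (ResidueField D)]
    {I : Ideal A} [IsPrecomplete I A]
    (h : (I.map (algebraMap A D)).radical = maximalIdeal D) : Module.Finite A D := by
  have hlt : I.map (algebraMap A D) ≠ ⊤ :=
    mt Ideal.radical_eq_top.2 (h ▸ (maximalIdeal.isMaximal D).ne_top)
  have : IsHausdorff (I.map (algebraMap A D)) D := .of_isLocalRing _ D hlt
  have : IsHausdorff I D := IsHausdorff.map_algebraMap_iff.1 this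
  have : Module.Finite A (D ⧸ maximalIdeal D) := ‹Module.Finite A (ResidueField D)›
  have hfin : Module.Finite A (D ⧸ I.map (algebraMap A D)) :=
    finite_quotient_of_le_radical (maximalIdeal D).fg_of_isNoetherianRing h.ge
  have : Module.Finite A (D ⧸ (I • ⊤ : Submodule A D)) := by
    rw [Ideal.smul_top_eq_map]
    exact hfin
  exact finite_of_finite_quotient_smul_top I

theorem exists_isPrime_dimensionLEOne_quotient {R : Type*} [CommRing R] [IsNoetherianRing R]
    [IsLocalRing R] {I : Ideal R} (h : ¬ maximalIdeal R ≤ I.radical) :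
    ∃ P : Ideal R, P.IsPrime ∧ I ≤ P ∧ ¬ maximalIdeal R ≤ P ∧ Ring.DimensionLEOne (R ⧸ P) := by
  have hne : {P : Ideal R | P.IsPrime ∧ I ≤ P ∧ ¬ maximalIdeal R ≤ P}.Nonempty := by
    contrapose! h
    rw [Ideal.radical_eq_sInf]
    refine le_sInf fun P ⟨hIP, hP⟩ ↦ by_contra fun hmP ↦ ?_
    exact h.subset ⟨hP, hIP, hmP⟩
  obtain ⟨P, ⟨hP, hIP, hmP⟩, hmax⟩ := set_has_maximal_iff_noetherian.2 ‹_› _ hne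
  refine ⟨P, hP, hIP, hmP, ⟨fun {Q} hQ0 hQ ↦ ?_⟩⟩
  have hmapcomap := Ideal.map_comap_of_surjective _ Ideal.Quotient.mk_surjective Q
  have hPQ : P < Q.comap (Ideal.Quotient.mk P) := by
    refine lt_of_le_of_ne (Ideal.mk_ker.ge.trans (Ideal.ker_le_comap _)) fun hPQ ↦ hQ0 ?_
    rw [← hmapcomap, ← hPQ, Ideal.map_quotient_self]
  have hmQ : maximalIdeal R ≤ Q.comap (Ideal.Quotient.mk P) := by
    by_contra hmQ
    exact hmax _ ⟨hQ.comap _, hIP.trans hPQ.le, hmQ⟩ hPQ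
  have hcomap : (Q.comap (Ideal.Quotient.mk P)).IsMaximal :=
    (maximalIdeal.isMaximal R).eq_of_le (hQ.comap _).ne_top hmQ ▸ maximalIdeal.isMaximal R
  exact hmapcomap ▸ (Ideal.map_eq_top_or_isMaximal_of_surjective _ Ideal.Quotient.mk_surjective
    hcomap).resolve_left (hmapcomap.symm ▸ hQ.ne_top)

end FiniteQuotients

section DiscreteValuationRing

variable {A : Type*} [CommRing A] [IsDomain A] [IsDiscreteValuationRing A]

theorem injective_of_map_irreducible_ne_zero {D : Type*} [CommRing D] [IsDomain D] (f : A →+* D)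
    {ϖ : A} (hϖ : Irreducible ϖ) (h : f ϖ ≠ 0) : Function.Injective f := by
  rw [RingHom.injective_iff_ker_eq_bot]
  by_contra hker
  have hmax := eq_maximalIdeal ((RingHom.ker_isPrime f).isMaximal hker)
  exact h (RingHom.mem_ker.1 (hmax ▸ hϖ.not_isUnit))

theorem isHausdorff_of_isIntegral {B : Type*} [CommRing B] [IsDomain B] [Algebra A B]
    [FaithfulSMul A B] [Algebra.IsIntegral A B] : IsHausdorff (maximalIdeal A) B := by
  obtain ⟨ϖ, hϖ⟩ := IsDiscreteValuationRing.exists_irreducible A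
  have hϖ0 : algebraMap A B ϖ ≠ 0 := by simpa using hϖ.ne_zero
  have hϖu : ¬ IsUnit (algebraMap A B ϖ) := fun h ↦ hϖ.not_isUnit ((isUnit_map_iff _ ϖ).1 h)
  refine ⟨fun b hb ↦ by_contra fun hb0 ↦ ?_⟩
  -- `b` divides a nonzero element of `A`, which bounds the powers of `ϖ` dividing `b`.
  obtain ⟨a, ha, hba⟩ := (Algebra.IsAlgebraic.isAlgebraic (R := A) b).exists_nonzero_dvd
    (mem_nonZeroDivisors_of_ne_zero hb0)
  obtain ⟨m, u, rfl⟩ := IsDiscreteValuationRing.eq_unit_mul_pow_irreducible ha hϖ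
  have hdvd : algebraMap A B ϖ ^ (m + 1) ∣ b := by
    have := hb (m + 1)
    rwa [SModEq.zero, hϖ.maximalIdeal_eq, Ideal.span_singleton_pow, Ideal.smul_top_eq_map,
      Ideal.map_span, Set.image_singleton, Submodule.restrictScalars_mem,
      Ideal.mem_span_singleton, map_pow] at this
  have hassoc : Associated (algebraMap A B (u * ϖ ^ m)) (algebraMap A B ϖ ^ m) := by
    rw [map_mul, map_pow]
    exact associated_unit_mul_left _ _ (u.isUnit.map _)
  exact absurd ((pow_dvd_pow_iff hϖ0 hϖu).1 ((hdvd.trans hba).trans hassoc.dvd)) (by lia)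

theorem finite_quotient_smul_top_of_rank_lt_aleph0 {M : Type*} [AddCommGroup M] [Module A M]
    [IsTorsionFree A M] (h : Module.rank A M < Cardinal.aleph0) :
    Module.Finite A (M ⧸ (maximalIdeal A • ⊤ : Submodule A M)) := by
  let b := Free.chooseBasis (ResidueField A) (TensorProduct A (ResidueField A) M)
  choose v hv using fun i ↦ TensorProduct.mk_surjective A M _ residue_surjective (b i)
  -- By flatness, lifts of linearly independent residues are linearly independent.
  have hli : LinearIndependent A v := IsLocalRing.linearIndependent_of_flat v <| by
    rw [show TensorProduct.mk A (ResidueField A) M 1 ∘ v = b from funext hv]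
    exact b.linearIndependent
  have : Finite (Free.ChooseBasisIndex (ResidueField A) (TensorProduct A (ResidueField A) M)) :=
    Cardinal.mk_lt_aleph0_iff.1 <| Cardinal.lift_lt_aleph0.1 <|
      hli.cardinal_lift_le_rank.trans_lt (Cardinal.lift_lt_aleph0.2 h)
  have : Module.Finite (ResidueField A) (TensorProduct A (ResidueField A) M) := .of_basis b
  have hfin : Module.Finite A (TensorProduct A (ResidueField A) M) := .trans (ResidueField A) _
  exact (Module.Finite.equiv_iff (TensorProduct.quotTensorEquivQuotSMul M (maximalIdeal A))).1 hfin

theorem finite_of_isIntegral_of_rank_lt_aleph0 [IsPrecomplete (maximalIdeal A) A] {B : Type*}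
    [CommRing B] [IsDomain B] [Algebra A B] [FaithfulSMul A B] [Algebra.IsIntegral A B]
    (h : Module.rank A B < Cardinal.aleph0) : Module.Finite A B := by
  have : IsHausdorff (maximalIdeal A) B := isHausdorff_of_isIntegral
  have := finite_quotient_smul_top_of_rank_lt_aleph0 h
  exact finite_of_finite_quotient_smul_top (maximalIdeal A)

variable (A) [IsPrecomplete (maximalIdeal A) A]

theorem finite_integralClosure (K L : Type*) [Field K] [Field L] [Algebra A K]
    [IsFractionRing A K] [Algebra A L] [Algebra K L] [IsScalarTower A K L]
    [FiniteDimensional K L] : Module.Finite A (integralClosure A L) := by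
  have : FaithfulSMul A K := (faithfulSMul_iff_algebraMap_injective A K).2
    (IsFractionRing.injective A K)
  have : FaithfulSMul A L := .trans A K L
  have hrank : Module.rank A L < Cardinal.aleph0 := by
    rw [← IsLocalization.rank_eq K (nonZeroDivisors A) le_rfl]
    exact rank_lt_aleph0 K L
  exact finite_of_isIntegral_of_rank_lt_aleph0 <|
    (Submodule.rank_le (integralClosure A L).toSubmodule).trans_lt hrank

theorem isDedekindDomain_integralClosure (K L : Type*) [Field K] [Field L] [Algebra A K]
    [IsFractionRing A K] [Algebra A L] [Algebra K L] [IsScalarTower A K L]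
    [FiniteDimensional K L] : IsDedekindDomain (integralClosure A L) := by
  have := finite_integralClosure A K L
  have : IsFractionRing (integralClosure A L) L :=
    IsIntegralClosure.isFractionRing_of_finite_extension A K L _
  exact
    { IsNoetherianRing.of_finite A (integralClosure A L),
      Ring.DimensionLEOne.of_isIntegral A (integralClosure A L),
      (isIntegrallyClosed_iff L).2 fun {x} hx ↦ ⟨⟨x, isIntegral_trans (R := A) x hx⟩, rfl⟩ with }

end DiscreteValuationRing

section Taylor

open PowerSeries
open scoped PowerSeries

variable {k V : Type*} [Field k] [CommRing V] [Algebra k V]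

/-- The expansion of `v` in powers of a uniformizer `π` of `V`, whose residue field is `k`. Here `δ`
stands for the difference quotient `v ↦ (v - res v) / π`, so that the `n`-th coefficient is
`res (δ ^ n v)`. -/
noncomputable def taylorSeries (res : V →ₗ[k] k) (δ : V →ₗ[k] V) : V →ₗ[k] k⟦X⟧ where
  toFun v := .mk fun n ↦ res ((δ ^ n) v)
  map_add' v w := by ext; simp only [map_add, coeff_mk]
  map_smul' c v := by ext; simp only [map_smul, coeff_mk, RingHom.id_apply]

theorem taylorSeries_eq_add_X_mul (res : V →ₗ[k] k) (δ : V →ₗ[k] V) (v : V) :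
    taylorSeries res δ v = C (res v) + X * taylorSeries res δ (δ v) := by
  ext n
  cases n with
  | zero => simp [taylorSeries]
  | succ n => simp [taylorSeries, coeff_succ_X_mul, pow_succ]

variable [IsDomain V] {res : V →ₐ[k] k} {π : V} (hπ : π ≠ 0)

include hπ

theorem exists_differenceQuotient (hres : ∀ v, res v = 0 ↔ π ∣ v) :
    ∃ δ : V →ₗ[k] V, ∀ v, v = algebraMap k V (res v) + π * δ v := by
  have hdvd (v : V) : π ∣ v - algebraMap k V (res v) := (hres _).1 (by simp)
  choose δ hδ using hdvd
  refine ⟨{ toFun := δ, map_add' := fun v w ↦ ?_, map_smul' := fun c v ↦ ?_ },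
    fun v ↦ sub_eq_iff_eq_add'.1 (hδ v)⟩
  · apply mul_left_cancel₀ hπ
    rw [mul_add, ← hδ, ← hδ, ← hδ, map_add, map_add]
    ring
  · apply mul_left_cancel₀ hπ
    rw [RingHom.id_apply, mul_smul_comm, ← hδ, ← hδ, map_smul, smul_eq_mul, map_mul, smul_sub,
      Algebra.smul_def, Algebra.smul_def]

section

variable {δ : V →ₗ[k] V} (hδ : ∀ v, v = algebraMap k V (res v) + π * δ v)

include hδ

theorem differenceQuotient_mul (v w : V) : δ (v * w) = δ v * w + res v • δ w := by
  have hvw := hδ (v * w)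
  rw [map_mul, map_mul] at hvw
  apply mul_left_cancel₀ hπ
  rw [Algebra.smul_def]
  linear_combination w * hδ v + algebraMap k V (res v) * hδ w - hvw

theorem taylorSeries_one : taylorSeries res.toLinearMap δ 1 = 1 := by
  have hδ1 : δ 1 = 0 := by simpa [hπ] using hδ 1
  simp [taylorSeries_eq_add_X_mul _ δ 1, hδ1]

theorem taylorSeries_mul (v w : V) : taylorSeries res.toLinearMap δ (v * w) =
    taylorSeries res.toLinearMap δ v * taylorSeries res.toLinearMap δ w := by
  set T := taylorSeries res.toLinearMap δ
  have hT (u : V) : T u = C (res u) + X * T (δ u) := taylorSeries_eq_add_X_mul _ δ u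
  -- Multiplicativity fails for `(v, w)` by `X` times its failure for `(δ v, w)`, so not at all.
  have hdefect (v : V) : T (v * w) - T v * T w = X * (T (δ v * w) - T (δ v) * T w) := by
    have hvw := hT (v * w)
    rw [differenceQuotient_mul hπ hδ, map_add, map_smul, smul_eq_C_mul, map_mul res,
      map_mul C] at hvw
    linear_combination hvw - T w * hT v - C (res v) * hT w
  rw [← sub_eq_zero]
  ext n
  induction n generalizing v with
  | zero => rw [hdefect, coeff_zero_X_mul, map_zero]
  | succ n ih => rw [hdefect, coeff_succ_X_mul, ih, map_zero, map_zero]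

end

theorem exists_algHom_powerSeries_apply_eq_X (hres : ∀ v, res v = 0 ↔ π ∣ v) :
    ∃ T : V →ₐ[k] k⟦X⟧, T π = X := by
  obtain ⟨δ, hδ⟩ := exists_differenceQuotient hπ hres
  have hresπ : res π = 0 := (hres π).2 dvd_rfl
  have hδπ : δ π = 1 := by simpa [hresπ, hπ] using hδ π
  refine ⟨.ofLinearMap (taylorSeries res.toLinearMap δ) (taylorSeries_one hπ hδ)
    (taylorSeries_mul hπ hδ), ?_⟩
  rw [AlgHom.ofLinearMap_apply, taylorSeries_eq_add_X_mul, hδπ, taylorSeries_one hπ hδ]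
  simp [hresπ]

end Taylor

theorem exists_injective_algHom_powerSeries_of_dvr {k V : Type*} [Field k] [CommRing V]
    [IsDomain V] [IsDiscreteValuationRing V] [Algebra k V] (res : V →ₐ[k] k) :
    ∃ T : V →ₐ[k] PowerSeries k, Function.Injective T := by
  obtain ⟨π, hπ⟩ := IsDiscreteValuationRing.exists_irreducible V
  have hres (v : V) : res v = 0 ↔ π ∣ v := by
    rw [← RingHom.mem_ker, ker_algHom_eq_maximalIdeal, hπ.maximalIdeal_eq,
      Ideal.mem_span_singleton]
  obtain ⟨T, hT⟩ := exists_algHom_powerSeries_apply_eq_X hπ.ne_zero hres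
  exact ⟨T, injective_of_map_irreducible_ne_zero T.toRingHom hπ (hT ▸ PowerSeries.X_ne_zero)⟩

section Branches

open PowerSeries
open scoped PowerSeries

variable {k : Type*} [Field k]

theorem isIntegral_of_algebraMap_X_eq_zero {F : Type*} [CommRing F] [Algebra k F] [Algebra k⟦X⟧ F]
    [IsScalarTower k k⟦X⟧ F] [Algebra.IsIntegral k⟦X⟧ F] (hX : algebraMap k⟦X⟧ F X = 0) :
    Algebra.IsIntegral k F := by
  have hfactor : algebraMap k⟦X⟧ F = (algebraMap k F).comp constantCoeff := by
    ext f
    have hf := congrArg (algebraMap k⟦X⟧ F) (sub_const_eq_X_mul_shift f)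
    rw [map_mul, hX, zero_mul, map_sub, sub_eq_zero] at hf
    rw [hf, RingHom.comp_apply, IsScalarTower.algebraMap_apply k k⟦X⟧ F, algebraMap_eq]
  refine ⟨fun x ↦ ?_⟩
  obtain ⟨p, hp, hpx⟩ := Algebra.IsIntegral.isIntegral (R := k⟦X⟧) x
  exact ⟨p.map constantCoeff, hp.map _, by rwa [Polynomial.eval₂_map, ← hfactor]⟩

variable [IsAlgClosed k]

theorem exists_algHom_apply_eq_zero_iff_mem {B : Type*} [CommRing B] [Algebra k B] [Algebra k⟦X⟧ B]
    [IsScalarTower k k⟦X⟧ B] [Algebra.IsIntegral k⟦X⟧ B] (M : Ideal B) [M.IsMaximal] :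
    ∃ ρ : B →ₐ[k] k, ∀ b, ρ b = 0 ↔ b ∈ M := by
  have hXM : algebraMap k⟦X⟧ B X ∈ M := by
    have hcomap := eq_maximalIdeal (Ideal.isMaximal_comap_of_isIntegral_of_isMaximal (R := k⟦X⟧) M)
    rw [← Ideal.mem_comap, hcomap, maximalIdeal_eq_span_X]
    exact Ideal.mem_span_singleton_self X
  have : Algebra.IsIntegral k (B ⧸ M) :=
    isIntegral_of_algebraMap_X_eq_zero (Ideal.Quotient.eq_zero_iff_mem.2 hXM)
  let e : k ≃ₐ[k] B ⧸ M :=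
    .ofBijective (Algebra.ofId k (B ⧸ M)) IsAlgClosed.algebraMap_bijective_of_isIntegral
  refine ⟨e.symm.toAlgHom.comp (Ideal.Quotient.mkₐ k M), fun b ↦ ?_⟩
  simp [Ideal.Quotient.eq_zero_iff_mem]

theorem exists_injective_algHom_powerSeries_of_isDedekindDomain {B : Type*} [CommRing B]
    [IsDedekindDomain B] [Algebra k B] [Algebra k⟦X⟧ B] [IsScalarTower k k⟦X⟧ B]
    [Algebra.IsIntegral k⟦X⟧ B] [FaithfulSMul k⟦X⟧ B] :
    ∃ φ : B →ₐ[k] k⟦X⟧, Function.Injective φ := by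
  obtain ⟨M, hM⟩ := Ideal.exists_maximal B
  have hM0 : M ≠ ⊥ := Ring.ne_bot_of_isMaximal_of_not_isField hM <|
    (Algebra.IsIntegral.isField_iff_isField (FaithfulSMul.algebraMap_injective k⟦X⟧ B)).not.1
      (IsDiscreteValuationRing.not_isField k⟦X⟧)
  obtain ⟨ρ, hρ⟩ := exists_algHom_apply_eq_zero_iff_mem (k := k) M
  let V := Localization.AtPrime M
  have : IsDiscreteValuationRing V :=
    IsLocalization.AtPrime.isDiscreteValuationRing_of_dedekind_domain B hM0 V
  let res : V →ₐ[k] k := IsLocalization.liftAlgHom (M := M.primeCompl) (f := ρ) fun y ↦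
    isUnit_iff_ne_zero.2 (mt (hρ y).1 y.2)
  obtain ⟨T, hT⟩ := exists_injective_algHom_powerSeries_of_dvr res
  exact ⟨T.comp (IsScalarTower.toAlgHom k B V), hT.comp (FaithfulSMul.algebraMap_injective B V)⟩

theorem exists_injective_algHom_powerSeries_of_finite {D : Type*} [CommRing D] [IsDomain D]
    [Algebra k D] [Algebra k⟦X⟧ D] [IsScalarTower k k⟦X⟧ D] [Module.Finite k⟦X⟧ D]
    [FaithfulSMul k⟦X⟧ D] : ∃ φ : D →ₐ[k] k⟦X⟧, Function.Injective φ := by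
  let L := FractionRing D
  have : FaithfulSMul k⟦X⟧ L := .trans k⟦X⟧ D L
  let : Algebra (FractionRing k⟦X⟧) L := FractionRing.liftAlgebra k⟦X⟧ L
  have : FiniteDimensional (FractionRing k⟦X⟧) L :=
    .of_isLocalization k⟦X⟧ D (nonZeroDivisors k⟦X⟧)
  have : IsPrecomplete (maximalIdeal k⟦X⟧) k⟦X⟧ := by
    rw [maximalIdeal_eq_span_X]
    infer_instance
  let B := integralClosure k⟦X⟧ L
  have : IsDedekindDomain B := isDedekindDomain_integralClosure k⟦X⟧ (FractionRing k⟦X⟧) L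
  have : FaithfulSMul k⟦X⟧ B := (faithfulSMul_iff_algebraMap_injective _ _).2 fun _ _ h ↦
    FaithfulSMul.algebraMap_injective k⟦X⟧ L (congrArg Subtype.val h)
  obtain ⟨φ, hφ⟩ := exists_injective_algHom_powerSeries_of_isDedekindDomain (k := k) (B := B)
  let ι : D →ₐ[k] B := (IsScalarTower.toAlgHom k D L).codRestrict (B.restrictScalars k) fun d ↦
    (Algebra.IsIntegral.isIntegral (R := k⟦X⟧) d).map (IsScalarTower.toAlgHom k⟦X⟧ D L)
  have hι : Function.Injective ι := (AlgHom.injective_codRestrict _ _ _).2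
    (FaithfulSMul.algebraMap_injective D L)
  exact ⟨φ.comp ι, hφ.comp hι⟩

end Branches

section MvPowerSeries

open MvPowerSeries

variable {σ R : Type*} [CommRing R]

theorem span_range_X_eq_ker_constantCoeff [Finite σ] :
    Ideal.span (Set.range X) = RingHom.ker (constantCoeff (σ := σ) (R := R)) := by
  classical
  have := Fintype.ofFinite σ
  refine le_antisymm (Ideal.span_le.2 ?_) fun f hf ↦ ?_
  · rintro _ ⟨i, rfl⟩
    exact constantCoeff_X i
  have hvar (e : σ →₀ ℕ) : e ≠ 0 → ∃ i, e i ≠ 0 := Finsupp.ne_iff.1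
  -- Collect in `part i` the monomials whose chosen variable `ν e` is `X i`.
  choose ν hν using hvar
  let part (i : σ) : MvPowerSeries σ R := fun e ↦ if ∃ he, ν e he = i then coeff e f else 0
  have hpart (i : σ) (e : σ →₀ ℕ) :
      coeff e (part i) = if ∃ he, ν e he = i then coeff e f else 0 := rfl
  have hsum : f = ∑ i, part i := by
    ext e
    rw [map_sum]
    by_cases he : e = 0
    · simpa [hpart, he] using hf
    · simp [hpart, he]
  rw [hsum]
  refine Ideal.sum_mem _ fun i _ ↦ Ideal.mem_of_dvd _ (X_dvd_iff.2 fun e he ↦ ?_)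
    (Ideal.subset_span ⟨i, rfl⟩)
  rw [hpart, if_neg]
  rintro ⟨he0, rfl⟩
  exact hν e he0 he

variable {k : Type*} [Field k]

variable (σ k) in
theorem maximalIdeal_eq_ker_constantCoeff :
    maximalIdeal (MvPowerSeries σ k) = RingHom.ker (constantCoeff (σ := σ) (R := k)) :=
  (eq_maximalIdeal <| RingHom.ker_isMaximal_of_surjective _ fun c ↦ ⟨C c, constantCoeff_C c⟩).symm

theorem mem_maximalIdeal_iff_constantCoeff {f : MvPowerSeries σ k} :
    f ∈ maximalIdeal (MvPowerSeries σ k) ↔ constantCoeff f = 0 := by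
  rw [maximalIdeal_eq_ker_constantCoeff, RingHom.mem_ker]

theorem maximalIdeal_eq_span_range_X [Finite σ] :
    maximalIdeal (MvPowerSeries σ k) = Ideal.span (Set.range X) := by
  rw [maximalIdeal_eq_ker_constantCoeff, span_range_X_eq_ker_constantCoeff]

instance finite_residueField_mvPowerSeries :
    Module.Finite k (ResidueField (MvPowerSeries σ k)) := by
  refine .of_surjective (Algebra.linearMap k _) fun x ↦ ?_
  obtain ⟨f, rfl⟩ := residue_surjective x
  refine ⟨constantCoeff f, ?_⟩
  rw [Algebra.linearMap_apply, IsScalarTower.algebraMap_apply k (MvPowerSeries σ k),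
    ResidueField.algebraMap_eq, ← sub_eq_zero, ← map_sub, residue_eq_zero_iff,
    mem_maximalIdeal_iff_constantCoeff]
  simp [MvPowerSeries.algebraMap_apply]

theorem constantCoeff_algHom_X (φ : MvPowerSeries σ k →ₐ[k] PowerSeries k) (i : σ) :
    PowerSeries.constantCoeff (φ (X i)) = 0 := by
  let χ : PowerSeries k →ₐ[k] k :=
    { PowerSeries.constantCoeff with commutes' := fun c ↦ PowerSeries.constantCoeff_C c }
  have hX : X i ∈ RingHom.ker (χ.comp φ) := by
    rw [ker_algHom_eq_maximalIdeal, mem_maximalIdeal_iff_constantCoeff, constantCoeff_X]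
  exact hX

theorem algHom_powerSeries_ext [Finite σ] {φ ψ : MvPowerSeries σ k →ₐ[k] PowerSeries k}
    (h : ∀ i, φ (X i) = ψ (X i)) : φ = ψ := by
  have := Fintype.ofFinite σ
  -- Continuity is automatic: each splitting `f = f(0) + ∑ gᵢ Xᵢ` gains one factor `X`.
  have hdvd (N : ℕ) (f : MvPowerSeries σ k) : PowerSeries.X ^ N ∣ φ f - ψ f := by
    induction N generalizing f with
    | zero => simp
    | succ N ih =>
      have hf : f - C (constantCoeff f) ∈ Ideal.span (Set.range X) := by
        rw [span_range_X_eq_ker_constantCoeff]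
        simp
      obtain ⟨g, hg⟩ := Ideal.mem_span_range_iff_exists_fun.1 hf
      have hmap (χ : MvPowerSeries σ k →ₐ[k] PowerSeries k) :
          χ f = algebraMap k _ (constantCoeff f) + ∑ i, χ (g i) * χ (X i) := by
        conv_lhs => rw [eq_add_of_sub_eq' hg.symm, map_add, map_sum]
        simp only [map_mul, ← χ.commutes, MvPowerSeries.algebraMap_apply, Algebra.algebraMap_self,
          RingHom.id_apply]
      have hdiff : φ f - ψ f = ∑ i, (φ (g i) - ψ (g i)) * φ (X i) := by
        rw [hmap φ, hmap ψ, add_sub_add_left_eq_sub, ← Finset.sum_sub_distrib]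
        simp only [h, sub_mul]
      rw [hdiff]
      exact Finset.dvd_sum fun i _ ↦ mul_dvd_mul (ih _)
        (PowerSeries.X_dvd_iff.2 (constantCoeff_algHom_X φ i))
  ext f n
  simpa [sub_eq_zero] using PowerSeries.X_pow_dvd_iff.1 (hdvd (n + 1) f) n (by simp)

theorem algHom_powerSeries_apply_eq_subst [Finite σ]
    (φ : MvPowerSeries σ k →ₐ[k] PowerSeries k) (f : MvPowerSeries σ k) :
    φ f = subst (fun i ↦ φ (X i)) f := by
  have hφ : HasSubst fun i ↦ φ (X i) :=
    hasSubst_of_constantCoeff_zero (constantCoeff_algHom_X φ)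
  have heq : φ = substAlgHom hφ := algHom_powerSeries_ext fun i ↦ (substAlgHom_X hφ i).symm
  rw [← substAlgHom_apply (R := k) hφ, ← heq]

end MvPowerSeries

section Curves

open scoped PowerSeries

variable {k : Type*} [Field k] [IsAlgClosed k]

theorem exists_injective_algHom_powerSeries_of_dimensionLEOne {D : Type*} [CommRing D] [IsDomain D]
    [IsNoetherianRing D] [IsLocalRing D] [Ring.DimensionLEOne D] [Algebra k D]
    [Module.Finite k (ResidueField D)] [Algebra k⟦X⟧ D] [IsScalarTower k k⟦X⟧ D]
    (hX0 : algebraMap k⟦X⟧ D PowerSeries.X ≠ 0)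
    (hX : algebraMap k⟦X⟧ D PowerSeries.X ∈ maximalIdeal D) :
    ∃ φ : D →ₐ[k] k⟦X⟧, Function.Injective φ := by
  have hrad : ((Ideal.span {PowerSeries.X}).map (algebraMap k⟦X⟧ D)).radical = maximalIdeal D := by
    rw [Ideal.map_span, Set.image_singleton]
    refine le_antisymm ?_ ?_
    · exact (maximalIdeal.isMaximal D).isPrime.radical_le_iff.2 <|
        (Ideal.span_singleton_le_iff_mem _).2 hX
    rw [Ideal.radical_eq_sInf]
    refine le_sInf fun Q ⟨hXQ, hQ⟩ ↦ (eq_maximalIdeal (hQ.isMaximal ?_)).ge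
    rintro rfl
    exact hX0 (by simpa using hXQ)
  have : Module.Finite k⟦X⟧ (ResidueField D) := .of_restrictScalars_finite k k⟦X⟧ _
  have : Module.Finite k⟦X⟧ D := finite_of_radical_map_eq_maximalIdeal hrad
  have : FaithfulSMul k⟦X⟧ D := (faithfulSMul_iff_algebraMap_injective _ _).2 <|
    injective_of_map_irreducible_ne_zero _ PowerSeries.X_irreducible hX0
  exact exists_injective_algHom_powerSeries_of_finite

variable {σ : Type*} [Finite σ] {I : Ideal (MvPowerSeries σ k)}

theorem exists_algHom_powerSeries_of_not_maximalIdeal_le_radical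
    (h : ¬ maximalIdeal (MvPowerSeries σ k) ≤ I.radical) :
    ∃ φ : MvPowerSeries σ k →ₐ[k] k⟦X⟧, I ≤ RingHom.ker φ ∧ ∃ i, φ (MvPowerSeries.X i) ≠ 0 := by
  obtain ⟨P, hP, hIP, hmP, hdim⟩ := exists_isPrime_dimensionLEOne_quotient h
  obtain ⟨i, hi⟩ : ∃ i, MvPowerSeries.X i ∉ P := by
    rw [maximalIdeal_eq_span_range_X, Ideal.span_le] at hmP
    simpa [Set.subset_def] using hmP
  let D := MvPowerSeries σ k ⧸ P
  let q : MvPowerSeries σ k →ₐ[k] D := Ideal.Quotient.mkₐ k P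
  have hq : Function.Surjective q := Ideal.Quotient.mk_surjective
  have hqi : q (MvPowerSeries.X i) ≠ 0 := mt Ideal.Quotient.eq_zero_iff_mem.1 hi
  have : IsLocalRing D := .of_surjective' q.toRingHom hq
  have : Module.Finite k (ResidueField D) := finite_residueField_of_surjective q hq
  let x : k⟦X⟧ →ₐ[k] D := q.comp (PowerSeries.toMvPowerSeries i)
  have hx : x PowerSeries.X = q (MvPowerSeries.X i) := by simp [x]
  have : IsLocalHom q.toRingHom := .of_surjective q.toRingHom hq
  have hqm : q (MvPowerSeries.X i) ∈ maximalIdeal D := mt (isUnit_of_map_unit q.toRingHom _) <|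
    mem_maximalIdeal_iff_constantCoeff.2 (MvPowerSeries.constantCoeff_X i)
  let : Algebra k⟦X⟧ D := x.toAlgebra
  have : IsScalarTower k k⟦X⟧ D := .of_algHom x
  obtain ⟨φ, hφ⟩ := exists_injective_algHom_powerSeries_of_dimensionLEOne (k := k) (D := D)
    (hx ▸ hqi) (hx ▸ hqm)
  refine ⟨φ.comp q, fun f hf ↦ ?_, i, ?_⟩
  · have hqf : q f = 0 := Ideal.Quotient.eq_zero_iff_mem.2 (hIP hf)
    rw [RingHom.mem_ker, AlgHom.comp_apply, hqf, map_zero]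
  · rwa [AlgHom.comp_apply, Ne, map_eq_zero_iff φ hφ]

theorem not_finiteDimensional_quotient_iff_exists_algHom :
    ¬ FiniteDimensional k (MvPowerSeries σ k ⧸ I) ↔
      ∃ φ : MvPowerSeries σ k →ₐ[k] k⟦X⟧, I ≤ RingHom.ker φ ∧ ∃ i, φ (MvPowerSeries.X i) ≠ 0 := by
  refine ⟨fun h ↦ exists_algHom_powerSeries_of_not_maximalIdeal_le_radical fun hmI ↦ h ?_, ?_⟩
  · have : Module.Finite k (MvPowerSeries σ k ⧸ maximalIdeal (MvPowerSeries σ k)) :=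
      finite_residueField_mvPowerSeries
    exact finite_quotient_of_le_radical (maximalIdeal _).fg_of_isNoetherianRing hmI
  · rintro ⟨φ, hI, i, hi⟩ hfin
    have : FiniteDimensional k (MvPowerSeries σ k ⧸ RingHom.ker φ) :=
      .of_surjective (Ideal.Quotient.factorₐ k hI).toLinearMap (Ideal.Quotient.factor_surjective hI)
    have := RingHom.ker_isPrime φ
    have : IsArtinianRing (MvPowerSeries σ k ⧸ RingHom.ker φ) := .of_finite k _
    have hmax := Ideal.Quotient.maximal_of_isField _
      (IsArtinianRing.isField_of_isDomain (MvPowerSeries σ k ⧸ RingHom.ker φ))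
    have hXi : MvPowerSeries.X i ∈ RingHom.ker φ := by
      rw [eq_maximalIdeal hmax, mem_maximalIdeal_iff_constantCoeff, MvPowerSeries.constantCoeff_X]
    exact hi hXi

end Curves

theorem lemma3p32_general {σ ι k : Type*} [Finite σ] [Field k] [IsAlgClosed k]
    (K : ι → MvPowerSeries σ k) :
    ¬ FiniteDimensional k (MvPowerSeries σ k ⧸ Ideal.span (Set.range K)) ↔
      ∃ μ : σ → PowerSeries k, (∀ i, PowerSeries.constantCoeff (μ i) = 0) ∧ μ ≠ 0 ∧
        ∀ j, MvPowerSeries.subst μ (K j) = 0 := by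
  rw [not_finiteDimensional_quotient_iff_exists_algHom]
  constructor
  · rintro ⟨φ, hK, i, hi⟩
    refine ⟨fun i ↦ φ (MvPowerSeries.X i), constantCoeff_algHom_X φ, Function.ne_iff.2 ⟨i, hi⟩,
      fun j ↦ ?_⟩
    rw [← algHom_powerSeries_apply_eq_subst]
    exact hK (Ideal.subset_span ⟨j, rfl⟩)
  · rintro ⟨μ, hμ0, hμ, hK⟩
    have hsubst := MvPowerSeries.hasSubst_of_constantCoeff_zero hμ0
    obtain ⟨i, hi⟩ := Function.ne_iff.1 hμ
    refine ⟨MvPowerSeries.substAlgHom hsubst, ?_, i, ?_⟩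
    · rw [Ideal.span_le]
      rintro _ ⟨j, rfl⟩
      simpa [MvPowerSeries.substAlgHom_apply] using hK j
    · rwa [MvPowerSeries.substAlgHom_X]

theorem lemma3p32 (n r : ℕ) (K : Fin r → MvPowerSeries (Fin n) ℂ) :
    (¬ FiniteDimensional ℂ (MvPowerSeries (Fin n) ℂ ⧸ Ideal.span (Set.range K))) ↔
      ∃ μ : Fin n → PowerSeries ℂ,
        (∀ i, PowerSeries.constantCoeff (μ i) = 0) ∧ μ ≠ 0 ∧
          ∀ j, formalComp (K j) μ = 0 :=
  lemma3p32_general K
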